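/- Let $G=(V,E)$ be a finite simple graph with $n=|V|$, let $p\colon V\to\mathbb{Z}_{>0}$, and let $\prec$ be an arbitrary linear order on $V$. For $v\in V$ let $\bar N^+(v)=\{w : v\prec w,\ \{v,w\}\notin E\}$ and $\bar N^-(v)=\{w : w\prec v,\ \{w,v\}\notin E\}$. Call $v$ a source if $\bar N^-(v)=\emptyset$ and a sink if $\bar N^+(v)=\emptyset$; let $S$ and $T$ be the sets of sources and sinks. Consider real variables $y$, $x_{vv}$ for each $v\in V\setminus S$, and $x_{uv}$ for each $u,v\in V$ with $u\prec v$, $\{u,v\}\notin E$ (in total $1+n+\bar e-|S|$ variables, where $\bar e$ is the number of edges of the complement of $G$), and put $\gamma_v=1$ if $v\in S$ and $\gamma_v=x_{vv}$ otherwise. For $v\in V\setminus T$ let $\mathcal{K}(v)$ be the collection of all subsets of $\bar N^+(v)$ that induce cliques of size $2$, or maximal cliques of size $1$, in $G[\bar N^+(v)]$. The relaxed representatives polytope $\mathcal{P}(G,p)$ is the convex hull of all $(y,x)\in\mathbb{R}_{\ge 0}\times\{0,1\}^{n+\bar e-|S|}$ such that - $x_{vv}+\sum_{u\in\bar N^-(v)}x_{uv}\ge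 1$ for all $v\in V\setminus S$, - $\sum_{w\in K}x_{vw}\le\gamma_v$ for all $v\in V\setminus T$ and $K\in\mathcal{K}(v)$, - $p(v)\gamma_v+\sum_{w\in\bar N^+(v)}p(w)x_{vw}\le y$ for all $v\in V$. For a graph $H$, the stable set polytope $\mathrm{STAB}(H)$ is the convex hull of the vectors $z\in\{0,1\}^{V(H)}$ with $z_a+z_b\le 1$ for all $\{a,b\}\in E(H)$. An inequality is facet-defining for $P$ if it is valid for $P$ and the face of $P$ on which it holds with equality is nonempty and has dimension $\dim P-1$. Theorem. Let $u\in V$, let $G^+(u)=G[\bar N^+(u)]$, and suppose that $\sum_{v\in\bar N^+(u)}\lambda_v z_v\le\lambda_0$ is facet-defining for $\mathrm{STAB}(G^+(u))$. If this inequality is a positive multiple of a nonnegativity constraint $-z_v\le 0$ for some $v \in \bar N^+(u)$, suppose also that $|\bar N^-(v)|\ge 2$. Then $$\sum_{v\in\bar N^+(u)}\lambda_v x_{uv}\le\lambda_0\gamma_u$$ is facet-defining for $\mathcal{P}(G,p)$. -/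

import Mathlib

namespace RepPoly

section Polyhedra

variable {E : Type*} [AddCommGroup E] [Module ℝ E]

/-- Dimension of a nonempty set: the dimension of its affine hull. -/
noncomputable def dim (s : Set E) : ℕ := Module.finrank ℝ (vectorSpan ℝ s)

/-- The inequality `lhs ≤ rhs` (both sides are affine functions wherever this is used) is
facet-defining for `P`: it is valid on `P`, and the face of `P` that it induces is nonempty and of
dimension `dim P - 1`. -/
def FacetDefining (P : Set E) (lhs rhs : E → ℝ) : Prop :=
  (∀ z ∈ P, lhs z ≤ rhs z) ∧
    {z ∈ P | lhs z = rhs z}.Nonempty ∧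
    dim {z ∈ P | lhs z = rhs z} + 1 = dim P

end Polyhedra

/-- The stable set polytope of a graph. -/
def stab {W : Type*} (H : SimpleGraph W) : Set (W → ℝ) :=
  convexHull ℝ {z | (∀ w, z w = 0 ∨ z w = 1) ∧ ∀ a b, H.Adj a b → z a + z b ≤ 1}

section Representatives

variable {V : Type*} [LinearOrder V] (G : SimpleGraph V)

/-- The positive anti-neighbourhood of `v`. -/
def posAnti (v : V) : Set V := {w | v < w ∧ ¬ G.Adj v w}

/-- The negative anti-neighbourhood of `v`. -/
def negAnti (v : V) : Set V := {u | u < v ∧ ¬ G.Adj u v}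

def IsSource (v : V) : Prop := negAnti G v = ∅

def IsSink (v : V) : Prop := posAnti G v = ∅

noncomputable instance [Finite V] (v : V) : Fintype (posAnti G v) := Fintype.ofFinite _

noncomputable instance [Finite V] (v : V) : Fintype (negAnti G v) := Fintype.ofFinite _

/-- The index set of the variables `x`: a variable `x_vv` for every `v` that is not a source, and a
variable `x_uv` for every pair of distinct nonadjacent vertices, ordered so that `u < v`. -/
abbrev RepVar : Type _ :=
  {v : V // ¬ IsSource G v} ⊕ {e : V × V // e.1 < e.2 ∧ ¬ G.Adj e.1 e.2}

variable {G}

/-- The variable `x_uv`, for `v` a positive anti-neighbour of `u`. -/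
def pairVar (u : V) (v : posAnti G u) : RepVar G := Sum.inr ⟨(u, v), v.2⟩

/-- The variable `x_uv`, for `u` a negative anti-neighbour of `v`. -/
def pairVar' (v : V) (u : negAnti G v) : RepVar G := Sum.inr ⟨(u, v), u.2⟩

open scoped Classical in
/-- `γ_v`, which is `1` if `v` is a source and `x_vv` otherwise. -/
noncomputable def gamma (x : RepVar G → ℝ) (v : V) : ℝ :=
  if h : IsSource G v then 1 else x (Sum.inl ⟨v, h⟩)

variable (G)

/-- The collection `𝒦(v)`: the vertex sets of the cliques of size 2, and of the maximal cliques of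
size 1, of the subgraph induced by the positive anti-neighbourhood of `v`. -/
def cliques (v : V) : Set (Finset (posAnti G v)) :=
  {K | (G.induce (posAnti G v)).IsNClique 2 K ∨
    ((G.induce (posAnti G v)).IsNClique 1 K ∧
      Maximal (fun s : Set (posAnti G v) => (G.induce (posAnti G v)).IsClique s) K)}

/-- The points `(y, x)`, with `x` a 0/1 vector, that satisfy all constraints of the representatives
formulation except the bound on the number of machines. -/
def feasible [Finite V] (p : V → ℕ) : Set (ℝ × (RepVar G → ℝ)) :=
  {yx | 0 ≤ yx.1 ∧
    (∀ i, yx.2 i = 0 ∨ yx.2 i = 1) ∧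
    (∀ v (hv : ¬ IsSource G v),
      1 ≤ (∑ u : negAnti G v, yx.2 (pairVar' v u)) + yx.2 (Sum.inl ⟨v, hv⟩)) ∧
    (∀ v, ¬ IsSink G v → ∀ K ∈ cliques G v,
      ∑ u ∈ K, yx.2 (pairVar v u) ≤ gamma yx.2 v) ∧
    (∀ v, (p v : ℝ) * gamma yx.2 v + ∑ u : posAnti G v, (p u : ℝ) * yx.2 (pairVar v u) ≤ yx.1)}

/-- The relaxed representatives polytope `𝒫(G, p)`. -/
def polytope [Finite V] (p : V → ℕ) : Set (ℝ × (RepVar G → ℝ)) :=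
  convexHull ℝ (feasible G p)

end Representatives

end RepPoly

/-! Choosing representatives, and for each of them a stable set to represent, gives a feasible `x`
once every vertex is covered; large `y` are always allowed. If all vertices represent themselves,
the stars (the vectors `x_v·`) can be chosen independently. Keeping the star of `u` on the given
facet, differences of such points span the kernel of the facet functional in that star and
everything in the other stars (`FacetDefining.ker_le`). Releasing `x_vv` while another vertex covers
`v` adds the diagonal directions, and raising `y` the vertical one. One point off the face completes
the whole space, so the face is a hyperplane section of full dimension
(`facetDefining_of_sup_eq_top`). The one obstruction is a `v` that only `u` can cover while `v`
vanishes on the facet. Then the facet is the nonnegativity constraint of `v`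
(`FacetDefining.nonneg_of_forall_eq_zero`), which the extra hypothesis rules out. -/

namespace RepPoly

/-! ### Faces, dimension and facets. -/

section Polyhedra

variable {E : Type*} [AddCommGroup E] [Module ℝ E]

/-- A face of a convex hull is the convex hull of the generators that it contains. -/
theorem mem_convexHull_face {s : Set E} {L : E →ₗ[ℝ] ℝ} {c : ℝ} (hs : ∀ z ∈ s, L z ≤ c)
    {z : E} (hz : z ∈ convexHull ℝ s) (hzc : L z = c) :
    z ∈ convexHull ℝ {w ∈ s | L w = c} := by
  have hle : ∀ w ∈ convexHull ℝ {w ∈ s | L w = c}, L w = c := fun w hw =>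
    convexHull_min (t := {w | L w = c}) (fun w hw => hw.2)
      (convex_hyperplane L.isLinear c) hw
  -- This set is convex: a proper mixture stays strictly below `c` unless both ends lie in the hull
  -- of the face.
  have key : convexHull ℝ s ⊆ {w | L w < c ∨ w ∈ convexHull ℝ {w ∈ s | L w = c}} := by
    refine convexHull_min (fun w hw => ?_) ?_
    · rcases (hs w hw).lt_or_eq with h | h
      · exact Or.inl h
      · exact Or.inr (subset_convexHull ℝ _ ⟨hw, h⟩)
    · rw [convex_iff_forall_pos]
      intro x hx y hy a b ha hb hab
      have hc : c = a * c + b * c := by rw [← add_mul, hab, one_mul]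
      have hL : L (a • x + b • y) = a * L x + b * L y := by simp
      rcases hx with hx | hx
      · left
        have hy' : L y ≤ c := hy.elim le_of_lt fun h => (hle y h).le
        rw [hL, hc]
        exact add_lt_add_of_lt_of_le (mul_lt_mul_of_pos_left hx ha)
          (mul_le_mul_of_nonneg_left hy' hb.le)
      · rcases hy with hy | hy
        · left
          rw [hL, hc, hle x hx]
          exact add_lt_add_of_le_of_lt le_rfl (mul_lt_mul_of_pos_left hy hb)
        · exact Or.inr (convex_convexHull ℝ _ hx hy ha.le hb.le hab)
  exact (key hz).resolve_left (by simp [hzc])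

theorem vectorSpan_le_ker {s : Set E} {L : E →ₗ[ℝ] ℝ} {c : ℝ} (hs : ∀ z ∈ s, L z = c) :
    vectorSpan ℝ s ≤ LinearMap.ker L := by
  rw [vectorSpan_def, Submodule.span_le]
  rintro _ ⟨a, ha, b, hb, rfl⟩
  simp [hs a ha, hs b hb]

variable [Module.Finite ℝ E]

/-- A valid inequality defines a facet as soon as its face, together with one point of the
polyhedron off the face, spans the whole space. -/
theorem facetDefining_of_sup_eq_top {P : Set E} {lhs rhs : E → ℝ} {L : E →ₗ[ℝ] ℝ} {c : ℝ}
    (hL : ∀ z, lhs z - rhs z = L z - c) (hvalid : ∀ z ∈ P, lhs z ≤ rhs z)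
    {f q : E} (hf : f ∈ {z ∈ P | lhs z = rhs z}) (hq : q ∈ P) (hne : lhs q ≠ rhs q)
    (htop : vectorSpan ℝ {z ∈ P | lhs z = rhs z} ⊔ Submodule.span ℝ {q - f} = ⊤) :
    FacetDefining P lhs rhs := by
  refine ⟨hvalid, ⟨f, hf⟩, ?_⟩
  set F := {z ∈ P | lhs z = rhs z}
  have hFL : ∀ z ∈ F, L z = c := fun z hz => by
    have := hL z
    rw [hz.2, sub_self] at this
    linarith
  have hker : vectorSpan ℝ F ≤ LinearMap.ker L := vectorSpan_le_ker hFL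
  have hqL : L (q - f) ≠ 0 := by
    rw [map_sub, hFL f hf, ← hL q]
    exact sub_ne_zero.2 hne
  have hP : vectorSpan ℝ P = ⊤ := by
    refine top_le_iff.1 (htop ▸ sup_le (vectorSpan_mono ℝ fun z hz => hz.1) ?_)
    rw [Submodule.span_singleton_le_iff_mem]
    exact vsub_mem_vectorSpan ℝ hq hf.1
  have hlt : Module.finrank ℝ (vectorSpan ℝ F) < Module.finrank ℝ E := by
    refine Submodule.finrank_lt fun h => hqL ?_
    have : q - f ∈ vectorSpan ℝ F := h ▸ Submodule.mem_top
    exact hker this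
  have hle := Submodule.finrank_add_le_finrank_add_finrank (vectorSpan ℝ F)
    (Submodule.span ℝ {q - f})
  have hd : q - f ≠ 0 := fun h => hqL (by rw [h, map_zero])
  rw [htop, finrank_top, finrank_span_singleton hd] at hle
  rw [dim, dim, hP, finrank_top]
  omega

/-- The direction space of a facet of a full-dimensional polyhedron is a hyperplane. -/
theorem FacetDefining.vectorSpan_eq_ker {P : Set E} {L : E →ₗ[ℝ] ℝ} {c : ℝ}
    (h : FacetDefining P L fun _ => c) (hP : vectorSpan ℝ P = ⊤) :
    vectorSpan ℝ {z ∈ P | L z = c} = LinearMap.ker L := by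
  obtain ⟨-, ⟨f, hf⟩, hdim⟩ := h
  have hL : L ≠ 0 := by
    rintro rfl
    have : {z ∈ P | (0 : E →ₗ[ℝ] ℝ) z = c} = P := by
      ext z
      have : 0 = c := hf.2
      simp [this]
    rw [this] at hdim
    omega
  refine Submodule.eq_of_le_of_finrank_eq (vectorSpan_le_ker fun z hz => hz.2) ?_
  have h1 := Module.Dual.finrank_ker_add_one_of_ne_zero (f := L) hL
  have h2 : Module.finrank ℝ (vectorSpan ℝ {z ∈ P | L z = c}) + 1 = Module.finrank ℝ E := by
    rw [← finrank_top ℝ E, ← hP]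
    exact hdim
  omega

end Polyhedra

/-! ### Facets of the stable set polytope. -/

section StableSets

variable {W : Type*} (H : SimpleGraph W)

/-- The incidence vectors of stable sets. -/
def IsStableVector (z : W → ℝ) : Prop :=
  (∀ w, z w = 0 ∨ z w = 1) ∧ ∀ a b, H.Adj a b → z a + z b ≤ 1

theorem IsStableVector.zero : IsStableVector H 0 := ⟨fun _ => Or.inl rfl, by simp⟩

theorem IsStableVector.single [DecidableEq W] (w : W) : IsStableVector H (Pi.single w 1) := by
  refine ⟨fun v => ?_, fun a b hab => ?_⟩
  · by_cases h : v = w <;> simp [h]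
  · by_cases ha : a = w
    · subst ha
      simp [hab.ne']
    · rw [Pi.single_eq_of_ne ha, zero_add, Pi.single_apply]
      split_ifs <;> simp

variable {H}

theorem IsStableVector.mem_stab {z : W → ℝ} (hz : IsStableVector H z) : z ∈ stab H :=
  subset_convexHull ℝ _ hz

theorem vectorSpan_stab [Finite W] : vectorSpan ℝ (stab H) = ⊤ := by
  classical
  have := Fintype.ofFinite W
  refine top_le_iff.1 ((Pi.basisFun ℝ W).span_eq.symm.trans_le (Submodule.span_le.2 ?_))
  rintro _ ⟨w, rfl⟩
  have := vsub_mem_vectorSpan ℝ (IsStableVector.single H w).mem_stab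
    (IsStableVector.zero H).mem_stab
  simpa using this

/-- The face is the hull of its 0/1 points, and taking hulls does not enlarge the affine span. -/
theorem vectorSpan_stab_face_le [Finite W] {L : (W → ℝ) →ₗ[ℝ] ℝ} {c : ℝ}
    (hL : ∀ z ∈ stab H, L z ≤ c) :
    vectorSpan ℝ {z ∈ stab H | L z = c} ≤ vectorSpan ℝ {z | IsStableVector H z ∧ L z = c} := by
  rw [← direction_affineSpan, ← direction_affineSpan, ← affineSpan_convexHull
    {z | IsStableVector H z ∧ L z = c}]
  refine AffineSubspace.direction_le (affineSpan_mono ℝ fun z hz => ?_)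
  exact mem_convexHull_face (fun w hw => hL w (subset_convexHull ℝ _ hw)) hz.1 hz.2

variable {L : (W → ℝ) →ₗ[ℝ] ℝ} {c : ℝ}

theorem FacetDefining.exists_stable (h : FacetDefining (stab H) L fun _ => c) :
    ∃ z, IsStableVector H z ∧ L z = c := by
  obtain ⟨hv, ⟨f, hf⟩, -⟩ := h
  have := mem_convexHull_face (fun w hw => hv w (subset_convexHull ℝ _ hw)) hf.1 hf.2
  exact convexHull_nonempty_iff.1 ⟨f, this⟩

theorem FacetDefining.ker_le [Finite W] (h : FacetDefining (stab H) L fun _ => c) :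
    LinearMap.ker L ≤ vectorSpan ℝ {z | IsStableVector H z ∧ L z = c} :=
  (h.vectorSpan_eq_ker vectorSpan_stab).ge.trans (vectorSpan_stab_face_le h.1)

theorem FacetDefining.exists_stable_ne (h : FacetDefining (stab H) L fun _ => c) :
    ∃ z, IsStableVector H z ∧ L z ≠ c := by
  by_contra! hz
  have : stab H ⊆ {z | L z = c} :=
    convexHull_min (fun z hz' => hz z hz') (convex_hyperplane L.isLinear c)
  have h3 := h.2.2
  have : {z ∈ stab H | L z = c} = stab H := Set.sep_eq_self_iff_mem_true.2 fun z hz => this hz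
  rw [this] at h3
  omega

/-- A facet of the stable set polytope on which the coordinate `v` vanishes is given by the
nonnegativity constraint of `v`. -/
theorem FacetDefining.nonneg_of_forall_eq_zero [Finite W] [DecidableEq W]
    (h : FacetDefining (stab H) L fun _ => c) {v : W}
    (hv : ∀ z, IsStableVector H z → L z = c → z v = 0) :
    c = 0 ∧ L (Pi.single v 1) < 0 ∧ ∀ w, w ≠ v → L (Pi.single w 1) = 0 := by
  have := Fintype.ofFinite W
  have hker : LinearMap.ker L ≤ LinearMap.ker (LinearMap.proj (R := ℝ) (φ := fun _ : W => ℝ) v) :=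
    h.ker_le.trans (vectorSpan_le_ker (c := 0) fun z hz => hv z hz.1 hz.2)
  have hw : ∀ w, w ≠ v → L (Pi.single w 1) = 0 := by
    intro w hwv
    -- The `v`-coordinate of this kernel vector is `L (Pi.single w 1)`, and it must vanish.
    have : L (Pi.single w 1) • (Pi.single v 1 : W → ℝ) - L (Pi.single v 1) • Pi.single w 1 ∈
        LinearMap.ker L := by
      simp [mul_comm]
    have := hker this
    simpa [hwv.symm] using this
  have hL : ∀ z : W → ℝ, L z = z v * L (Pi.single v 1) := by
    intro z
    conv_lhs => rw [← Finset.univ_sum_single z]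
    rw [map_sum, Finset.sum_eq_single v]
    · rw [← smul_eq_mul, ← map_smul, ← Pi.single_smul', smul_eq_mul, mul_one]
    · intro b _ hb
      have h1 : (Pi.single b (z b) : W → ℝ) = z b • Pi.single b 1 := by
        rw [← Pi.single_smul', smul_eq_mul, mul_one]
      exact (congrArg L h1).trans (by rw [map_smul, hw b hb, smul_zero])
    · simp
  obtain ⟨z, hz, hzc⟩ := h.exists_stable
  have hc : c = 0 := by rw [← hzc, hL, hv z hz hzc, zero_mul]
  refine ⟨hc, lt_of_le_of_ne (hc ▸ h.1 _ (IsStableVector.single H v).mem_stab) fun h0 => ?_, hw⟩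
  obtain ⟨q, -, hq⟩ := h.exists_stable_ne
  exact hq (by rw [hL, h0, mul_zero, hc])

end StableSets

/-! ### Configurations and the directions they span. -/

section Representatives

variable {V : Type*} [LinearOrder V] {G : SimpleGraph V}

/-- The bound on cliques of `𝒦(v)`, split into bounds on vertices and on edges. -/
theorem sum_cliques_le_iff {v : V} {z : posAnti G v → ℝ} (hz : ∀ w, 0 ≤ z w) {c : ℝ} :
    (∀ K ∈ cliques G v, ∑ w ∈ K, z w ≤ c) ↔
      (∀ w, z w ≤ c) ∧ ∀ a b, (G.induce (posAnti G v)).Adj a b → z a + z b ≤ c := by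
  constructor
  · intro h
    have hE : ∀ a b, (G.induce (posAnti G v)).Adj a b → z a + z b ≤ c := by
      intro a b hab
      have := h {a, b} (Or.inl ?_)
      · rwa [Finset.sum_pair hab.ne] at this
      · rw [SimpleGraph.isNClique_iff, Finset.card_pair hab.ne]
        rw [Finset.coe_pair, SimpleGraph.isClique_pair]
        exact ⟨fun _ => hab, rfl⟩
    refine ⟨fun w => ?_, hE⟩
    -- A singleton belongs to `cliques G v` only when its vertex is isolated; otherwise an edge
    -- bound and `0 ≤ z b` give the vertex bound.
    by_cases hw : ∃ b, (G.induce (posAnti G v)).Adj w b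
    · obtain ⟨b, hb⟩ := hw
      linarith [hE w b hb, hz b]
    · have := h {w} (Or.inr ⟨?_, ?_⟩)
      · rwa [Finset.sum_singleton] at this
      · simp [SimpleGraph.isNClique_iff]
      · refine ⟨by simp, fun t ht hwt b hb => ?_⟩
        by_contra hbw
        refine hw ⟨b, ht (hwt (by simp)) hb ?_⟩
        rintro rfl
        exact hbw (by simp)
  · rintro ⟨h1, h2⟩ K (hK | ⟨hK, -⟩)
    · obtain ⟨a, b, hne, rfl⟩ := Finset.card_eq_two.1 hK.card_eq
      have hab : (G.induce (posAnti G v)).Adj a b := hK.isClique (by simp) (by simp) hne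
      rw [Finset.sum_pair hab.ne]
      exact h2 a b hab
    · rw [SimpleGraph.isNClique_one] at hK
      obtain ⟨a, rfl⟩ := hK
      simpa using h1 a

/-- The `x`-part of a point, assembled from the diagonal variables and from one vector on the
positive anti-neighbourhood of each vertex. -/
def point (G : SimpleGraph V) :
    (V → ℝ) × (∀ v, posAnti G v → ℝ) →ₗ[ℝ] (RepVar G → ℝ) where
  toFun q := Sum.elim (fun v => q.1 v) (fun e => q.2 e.1.1 ⟨e.1.2, e.2⟩)
  map_add' q r := by ext (i | i) <;> rfl
  map_smul' c q := by ext (i | i) <;> rfl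

@[simp] theorem point_inl (q) (v : {v : V // ¬ IsSource G v}) :
    point G q (Sum.inl v) = q.1 v := rfl

@[simp] theorem point_pairVar (q) (v : V) (w : posAnti G v) :
    point G q (pairVar v w) = q.2 v w := rfl

theorem point_surjective : Function.Surjective (point G) := by
  classical
  intro x
  refine ⟨(fun v => gamma x v, fun v w => x (pairVar v w)), ?_⟩
  ext (⟨v, hv⟩ | i)
  · simp [gamma, hv]
  · rfl

/-- A choice of representatives `v` (those with `g v = 1`), each with the stable set `Z v` of
vertices that it represents, such that every vertex is represented. -/
structure IsConfiguration (g : V → ℝ) (Z : ∀ v, posAnti G v → ℝ) : Prop where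
  zero_or_one : ∀ v, g v = 0 ∨ g v = 1
  stable : ∀ v, IsStableVector (G.induce (posAnti G v)) (Z v)
  of_eq_zero : ∀ v, g v = 0 → ¬ IsSource G v ∧ Z v = 0
  cover : ∀ v, g v = 0 → ∃ (w : V) (hw : v ∈ posAnti G w), Z w ⟨v, hw⟩ = 1

theorem IsConfiguration.one {Z : ∀ v, posAnti G v → ℝ}
    (hZ : ∀ v, IsStableVector (G.induce (posAnti G v)) (Z v)) : IsConfiguration 1 Z :=
  ⟨fun _ => Or.inr rfl, hZ, fun _ h => absurd h one_ne_zero, fun _ h => absurd h one_ne_zero⟩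

/-- Compared with `IsConfiguration.one` for the same `Z`, this isolates the diagonal direction of
`v`. -/
theorem IsConfiguration.update_zero {Z : ∀ v, posAnti G v → ℝ}
    (hZ : ∀ v, IsStableVector (G.induce (posAnti G v)) (Z v)) {v : V} (hv : ¬ IsSource G v)
    (hZv : Z v = 0) (hcover : ∃ (w : V) (hw : v ∈ posAnti G w), Z w ⟨v, hw⟩ = 1) :
    IsConfiguration (Function.update 1 v 0) Z := by
  have key : ∀ w, Function.update (1 : V → ℝ) v 0 w = 0 → w = v := by
    intro w hw
    by_contra h
    rw [Function.update_of_ne h] at hw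
    exact one_ne_zero hw
  refine ⟨fun w => ?_, hZ, fun w hw => ?_, fun w hw => ?_⟩
  · by_cases h : w = v
    · left
      rw [h, Function.update_self]
    · right
      rw [Function.update_of_ne h]
      rfl
  · rw [key w hw]
    exact ⟨hv, hZv⟩
  · rw [key w hw]
    exact hcover

theorem IsConfiguration.gamma_point {g : V → ℝ} {Z : ∀ v, posAnti G v → ℝ}
    (h : IsConfiguration g Z) (v : V) : gamma (point G (g, Z)) v = g v := by
  by_cases hv : IsSource G v
  · rw [gamma, dif_pos hv]
    exact ((h.zero_or_one v).resolve_left fun h' => (h.of_eq_zero v h').1 hv).symm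
  · rw [gamma, dif_neg hv, point_inl]

theorem IsConfiguration.exists_mem_feasible [Finite V] (p : V → ℕ) {g : V → ℝ}
    {Z : ∀ v, posAnti G v → ℝ} (h : IsConfiguration g Z) :
    ∃ Y, ∀ y, Y ≤ y → (y, point G (g, Z)) ∈ feasible G p := by
  have := Fintype.ofFinite V
  have hgamma := h.gamma_point
  obtain ⟨hg, hZ, hgZ, hcover⟩ := h
  have h01 : ∀ i, point G (g, Z) i = 0 ∨ point G (g, Z) i = 1 := by
    rintro (i | i)
    · exact hg i
    · exact (hZ _).1 _
  have hnn : ∀ i, 0 ≤ point G (g, Z) i := fun i => by rcases h01 i with h | h <;> simp [h]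
  let load : V → ℝ := fun v => (p v : ℝ) * gamma (point G (g, Z)) v +
    ∑ w : posAnti G v, (p w : ℝ) * point G (g, Z) (pairVar v w)
  refine ⟨∑ v, |load v|, fun y hy => ⟨?_, h01, fun v hv => ?_, fun v _ => ?_, fun v => ?_⟩⟩
  · exact (Finset.sum_nonneg fun v _ => abs_nonneg _).trans hy
  · rcases hg v with h | h
    · obtain ⟨w, hw, hwv⟩ := hcover v h
      have : point G (g, Z) (pairVar' v ⟨w, hw⟩) ≤
          ∑ w : negAnti G v, point G (g, Z) (pairVar' v w) :=
        Finset.single_le_sum (f := fun w => point G (g, Z) (pairVar' v w))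
          (fun w _ => hnn _) (Finset.mem_univ _)
      have h1 : point G (g, Z) (pairVar' v ⟨w, hw⟩) = 1 := hwv
      have := hnn (Sum.inl ⟨v, hv⟩)
      dsimp only
      linarith
    · have : point G (g, Z) (Sum.inl ⟨v, hv⟩) = 1 := h
      dsimp only
      rw [this]
      exact le_add_of_nonneg_left (Finset.sum_nonneg fun w _ => hnn _)
  · refine (sum_cliques_le_iff (z := fun w => point G (g, Z) (pairVar v w))
      fun w => hnn _).2 ?_
    dsimp only
    rw [hgamma]
    rcases hg v with h | h
    · simp [h, (hgZ v h).2]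
    · rw [h]
      refine ⟨fun w => ?_, (hZ v).2⟩
      rcases (hZ v).1 w with h | h <;> simp [h]
  · exact (le_abs_self _).trans
      ((Finset.single_le_sum (f := fun v => |load v|) (fun v _ => abs_nonneg _)
        (Finset.mem_univ v)).trans hy)

/-- At a feasible point the variables `x_uv` form `γ_u` times a stable vector. -/
theorem star_of_mem_feasible [Finite V] {p : V → ℕ} {yx : ℝ × (RepVar G → ℝ)}
    (h : yx ∈ feasible G p) {u : V} (hu : ¬ IsSink G u) :
    (gamma yx.2 u = 1 ∧
      IsStableVector (G.induce (posAnti G u)) fun v => yx.2 (pairVar u v)) ∨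
    (gamma yx.2 u = 0 ∧ ∀ v, yx.2 (pairVar u v) = 0) := by
  obtain ⟨-, h01, -, hK, -⟩ := h
  have hnn : ∀ i, 0 ≤ yx.2 i := fun i => by rcases h01 i with h | h <;> simp [h]
  have hK := (sum_cliques_le_iff (z := fun w => yx.2 (pairVar u w)) fun w => hnn _).1 (hK u hu)
  have hg : gamma yx.2 u = 0 ∨ gamma yx.2 u = 1 := by
    rw [gamma]
    split_ifs
    · exact Or.inr rfl
    · exact h01 _
  rcases hg with hg | hg
  · exact Or.inr ⟨hg, fun v => le_antisymm (hg ▸ hK.1 v) (hnn _)⟩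
  · rw [hg] at hK
    exact Or.inl ⟨hg, fun w => h01 _, hK.2⟩

/-- Vectors between points on vertical rays of `F` are parallel to `F`. -/
theorem mk_sub_mem_vectorSpan {X : Type*} [AddCommGroup X] [Module ℝ X] {F : Set (ℝ × X)}
    {x x' : X} (hx : ∃ Y, ∀ y, Y ≤ y → (y, x) ∈ F) (hx' : ∃ Y, ∀ y, Y ≤ y → (y, x') ∈ F) (t : ℝ) :
    (t, x - x') ∈ vectorSpan ℝ F := by
  obtain ⟨Y, hY⟩ := hx
  obtain ⟨Y', hY'⟩ := hx'
  -- Heights differing by exactly `t`, each above its own threshold.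
  have h1 : Y ≤ max (Y - t) Y' + t := by linarith [le_max_left (Y - t) Y']
  have := vsub_mem_vectorSpan ℝ (hY _ h1) (hY' _ (le_max_right (Y - t) Y'))
  simpa using this

theorem stable_update {Z : ∀ v, posAnti G v → ℝ}
    (hZ : ∀ v, IsStableVector (G.induce (posAnti G v)) (Z v)) {u : V} {z : posAnti G u → ℝ}
    (hz : IsStableVector (G.induce (posAnti G u)) z) (v : V) :
    IsStableVector (G.induce (posAnti G v)) (Function.update Z u z v) :=
  (Function.forall_update_iff Z
    (p := fun v z => IsStableVector (G.induce (posAnti G v)) z)).2 ⟨hz, fun v _ => hZ v⟩ v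

/-- A subspace contains all of the model space if it contains all diagonal and star directions. -/
theorem eq_top_of_single_mem [Finite V]
    {N : Submodule ℝ ((V → ℝ) × (∀ v, posAnti G v → ℝ))}
    (hg : ∀ v, (Pi.single v 1, 0) ∈ N) (hZ : ∀ v ζ, (0, Pi.single v ζ) ∈ N) : N = ⊤ := by
  have := Fintype.ofFinite V
  refine top_le_iff.1 fun q _ => ?_
  have h1 : q = ∑ v, (q.1 v • (Pi.single v 1, 0) + (0, Pi.single v (q.2 v))) := by
    rw [Finset.sum_add_distrib]
    refine Prod.ext ?_ ?_
    · simp only [Prod.fst_add, Prod.fst_sum, Prod.smul_fst, Finset.sum_const_zero, add_zero]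
      ext w
      simp [Finset.sum_apply, Pi.single_apply]
    · simp only [Prod.snd_add, Prod.snd_sum, Prod.smul_snd, smul_zero, Finset.sum_const_zero,
        zero_add]
      exact (Finset.univ_sum_single q.2).symm
  rw [h1]
  exact Submodule.sum_mem _ fun v _ => N.add_mem (N.smul_mem _ (hg v)) (hZ v _)

/-- The directions spanned by the configurations that satisfy a facet of the star of `u` with
equality, together with one direction in the star that is transversal to this facet. -/
theorem eq_top_of_configuration_sub_mem [Finite V] {u : V} {L : (posAnti G u → ℝ) →ₗ[ℝ] ℝ}
    {c : ℝ} (h : FacetDefining (stab (G.induce (posAnti G u))) L fun _ => c)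
    (hnonneg : ∀ v, c = 0 → L (Pi.single v 1) < 0 →
      (∀ w, w ≠ v → L (Pi.single w 1) = 0) → 2 ≤ (negAnti G (v : V)).ncard)
    {N : Submodule ℝ ((V → ℝ) × (∀ v, posAnti G v → ℝ))}
    (hsub : ∀ g Z g' Z', IsConfiguration g Z → IsConfiguration g' Z' →
      L (Z u) = c * g u → L (Z' u) = c * g' u → (g - g', Z - Z') ∈ N)
    (hsource : ∀ v, IsSource G v → (Pi.single v 1, 0) ∈ N)
    {d : posAnti G u → ℝ} (hd : L d ≠ 0) (hdN : (0, Pi.single u d) ∈ N) : N = ⊤ := by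
  obtain ⟨z₀, hz₀, hz₀c⟩ := h.exists_stable
  have hzero : ∀ v, IsStableVector (G.induce (posAnti G v))
      ((0 : ∀ v, posAnti G v → ℝ) v) := fun v => IsStableVector.zero _
  have hbase := stable_update hzero hz₀
  have hsub' : ∀ Z Z', (∀ v, IsStableVector (G.induce (posAnti G v)) (Z v)) →
      (∀ v, IsStableVector (G.induce (posAnti G v)) (Z' v)) → L (Z u) = c → L (Z' u) = c →
      (0, Z - Z') ∈ N := by
    intro Z Z' hZ hZ' hc hc'
    have := hsub 1 Z 1 Z' (.one hZ) (.one hZ') (by simpa using hc) (by simpa using hc')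
    rwa [sub_self] at this
  have hstar_u : ∀ ζ, (0, Pi.single u ζ) ∈ N := by
    let K := N.comap (LinearMap.inr ℝ (V → ℝ) (∀ v, posAnti G v → ℝ) ∘ₗ
      LinearMap.single ℝ (fun v => posAnti G v → ℝ) u)
    have hK : LinearMap.ker L ≤ K := by
      refine h.ker_le.trans ?_
      rw [vectorSpan_def, Submodule.span_le]
      rintro _ ⟨a, ha, b, hb, rfl⟩
      have := hsub' _ _ (stable_update hzero ha.1) (stable_update hzero hb.1)
        (by simpa using ha.2) (by simpa using hb.2)
      change (0, Pi.single u (a - b)) ∈ N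
      rwa [Pi.single_sub]
    intro ζ
    -- Split `ζ` along `d` into a part in the kernel of `L` and a multiple of `d`.
    have h1 : ζ - (L ζ / L d) • d ∈ K := hK (by simp [hd])
    have h2 := K.add_mem h1 (K.smul_mem (L ζ / L d) (show d ∈ K from hdN))
    rw [sub_add_cancel] at h2
    exact h2
  have hstar : ∀ v ζ, (0, Pi.single v ζ) ∈ N := by
    intro v
    by_cases hv : v = u
    · subst hv
      exact hstar_u
    let K := N.comap (LinearMap.inr ℝ (V → ℝ) (∀ v, posAnti G v → ℝ) ∘ₗ
      LinearMap.single ℝ (fun v => posAnti G v → ℝ) v)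
    suffices hK : ⊤ ≤ K from fun ζ => hK (Submodule.mem_top (x := ζ))
    refine (Pi.basisFun ℝ (posAnti G v)).span_eq.symm.trans_le (Submodule.span_le.2 ?_)
    rintro _ ⟨w, rfl⟩
    have h1 := hsub' _ _ (stable_update hbase (IsStableVector.single _ w)) hbase
      (by simpa [Function.update_of_ne (Ne.symm hv)] using hz₀c) (by simpa using hz₀c)
    change (0, Pi.single v (Pi.basisFun ℝ (posAnti G v) w)) ∈ N
    convert h1 using 2
    ext a b
    by_cases ha : a = v
    · subst ha
      simp [Function.update_of_ne hv]
    · simp [Function.update_of_ne ha, Pi.single_eq_of_ne ha]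
  have hdiff : ∀ v : V, (1 : V → ℝ) - Function.update (1 : V → ℝ) v 0 = Pi.single v 1 := by
    intro v
    ext a
    by_cases ha : a = v
    · subst ha
      simp
    · simp [Function.update_of_ne ha, Pi.single_eq_of_ne ha]
  refine eq_top_of_single_mem (fun v => ?_) hstar
  by_cases hs : IsSource G v
  · exact hsource v hs
  by_cases hv : v = u
  · subst hv
    obtain ⟨w, hw⟩ := Set.nonempty_iff_ne_empty.2 hs
    have hwv : w ≠ v := hw.1.ne
    have hsw : IsStableVector (G.induce (posAnti G w)) (Pi.single ⟨v, hw⟩ 1) :=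
      IsStableVector.single _ _
    -- Switching `u` off forces its star from `z₀` to `0`, where the equality reads `0 = 0`; the
    -- star part of the difference is then subtracted.
    have h1 := hsub 1 _ _ _ (.one (stable_update hbase hsw))
      (.update_zero (stable_update hzero hsw) hs (by simp [Function.update_of_ne hwv.symm])
        ⟨w, hw, by simp⟩)
      (by simpa [Function.update_of_ne hwv.symm] using hz₀c)
      (by simp [Function.update_of_ne hwv.symm])
    have h2 := N.sub_mem h1 (hstar v z₀)
    rw [hdiff, Prod.mk_sub_mk, sub_zero] at h2
    convert h2 using 2
    ext a b
    by_cases ha : a = w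
    · subst ha
      simp [Pi.single_eq_of_ne hwv]
    · by_cases hav : a = v
      · subst hav
        simp [Function.update_of_ne ha]
      · simp [Function.update_of_ne ha, Function.update_of_ne hav, Pi.single_eq_of_ne hav]
  · suffices hZ : ∃ Z : ∀ v, posAnti G v → ℝ,
        (∀ v, IsStableVector (G.induce (posAnti G v)) (Z v)) ∧ L (Z u) = c ∧ Z v = 0 ∧
        ∃ (w : V) (hw : v ∈ posAnti G w), Z w ⟨v, hw⟩ = 1 by
      obtain ⟨Z, hZ, hc, hZv, hcover⟩ := hZ
      have := hsub _ _ _ _ (.one hZ) (.update_zero hZ hs hZv hcover) (by simpa using hc)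
        (by simpa [Function.update_of_ne (Ne.symm hv)] using hc)
      rwa [hdiff, sub_self] at this
    by_cases hw : ∃ w ∈ negAnti G v, w ≠ u
    · obtain ⟨w, hw, hwu⟩ := hw
      have hwv : v ≠ w := hw.1.ne'
      exact ⟨_, stable_update hbase (IsStableVector.single _ (⟨v, hw⟩ : posAnti G w)),
        by simpa [Function.update_of_ne hwu.symm] using hz₀c,
        by simp [Function.update_of_ne hwv, Function.update_of_ne hv], w, hw, by simp⟩
    -- Only `u` can cover `v`, so a stable vector on the facet containing `v` is needed.
    · push Not at hw
      obtain ⟨w, hwv⟩ := Set.nonempty_iff_ne_empty.2 hs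
      obtain rfl := hw w hwv
      by_cases hz : ∃ z, IsStableVector (G.induce (posAnti G w)) z ∧ L z = c ∧ z ⟨v, hwv⟩ ≠ 0
      · obtain ⟨z, hz, hzc, hzv⟩ := hz
        exact ⟨_, stable_update hzero hz, by simpa using hzc,
          by simp [Function.update_of_ne hv], w, hwv, by simpa using (hz.1 _).resolve_left hzv⟩
      · push Not at hz
        obtain ⟨h1, h2, h3⟩ := h.nonneg_of_forall_eq_zero hz
        have h4 := hnonneg _ h1 h2 h3
        have h5 : negAnti G v ⊆ {w} := fun a ha => hw a ha
        have h6 := Set.ncard_le_ncard h5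
        rw [Set.ncard_singleton] at h6
        have h4 : 2 ≤ (negAnti G v).ncard := h4
        omega

end Representatives

end RepPoly

/-! ### The facet theorem. -/

theorem mainTheorem1 {V : Type*} [Finite V] [LinearOrder V] (G : SimpleGraph V)
    (p : V → ℕ) (hp : ∀ v, 0 < p v) (u : V)
    (lam : RepPoly.posAnti G u → ℝ) (lam0 : ℝ)
    (hnonneg : ∀ v : RepPoly.posAnti G u,
      lam0 = 0 → lam v < 0 → (∀ w, w ≠ v → lam w = 0) → 2 ≤ (RepPoly.negAnti G (v : V)).ncard)
    (hfacet : RepPoly.FacetDefining (RepPoly.stab (G.induce (RepPoly.posAnti G u)))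
      (fun z => ∑ v, lam v * z v) (fun _ => lam0)) :
    RepPoly.FacetDefining (RepPoly.polytope G p)
      (fun yx => ∑ v, lam v * yx.2 (RepPoly.pairVar u v))
      (fun yx => lam0 * RepPoly.gamma yx.2 u) := by
  open RepPoly in
  classical
  obtain ⟨L, hL⟩ : ∃ L : (posAnti G u → ℝ) →ₗ[ℝ] ℝ, ∀ z, L z = ∑ v, lam v * z v :=
    ⟨∑ v, lam v • LinearMap.proj v, fun z => by simp⟩
  have hfacet' : FacetDefining (stab (G.induce (posAnti G u))) L fun _ => lam0 := by
    convert hfacet using 1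
    exact funext hL
  have hLs : ∀ v, L (Pi.single v 1) = lam v := fun v => by simp [hL, Pi.single_apply]
  obtain ⟨z₀, hz₀, hz₀c⟩ := hfacet'.exists_stable
  obtain ⟨z₁, hz₁, hz₁c⟩ := hfacet'.exists_stable_ne
  have hsink : ¬ IsSink G u := by
    intro h
    have : IsEmpty (posAnti G u) := Set.isEmpty_coe_sort.2 h
    exact hz₁c (Subsingleton.elim z₀ z₁ ▸ hz₀c)
  obtain ⟨Λ, c, hΛ⟩ : ∃ (Λ : (ℝ × (RepVar G → ℝ)) →ₗ[ℝ] ℝ) (c : ℝ), ∀ yx,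
      ∑ v, lam v * yx.2 (pairVar u v) - lam0 * gamma yx.2 u = Λ yx - c := by
    let Λ₀ : (ℝ × (RepVar G → ℝ)) →ₗ[ℝ] ℝ :=
      ∑ v, lam v • (LinearMap.proj (pairVar u v) ∘ₗ LinearMap.snd ℝ ℝ (RepVar G → ℝ))
    -- For a source, `gamma` is the constant `1`, so `lam0` moves into the constant term.
    by_cases hu : IsSource G u
    · exact ⟨Λ₀, lam0, fun yx => by simp [Λ₀, gamma, hu]⟩
    · exact ⟨Λ₀ - lam0 • (LinearMap.proj (Sum.inl ⟨u, hu⟩) ∘ₗ LinearMap.snd ℝ ℝ (RepVar G → ℝ)),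
        0, fun yx => by simp [Λ₀, gamma, hu]⟩
  have hvalid : ∀ yx ∈ polytope G p,
      ∑ v, lam v * yx.2 (pairVar u v) ≤ lam0 * gamma yx.2 u := by
    have : polytope G p ⊆ {yx | Λ yx ≤ c} := by
      refine convexHull_min (fun yx h => ?_) (convex_halfSpace_le Λ.isLinear c)
      have h1 := hΛ yx
      have h2 : ∑ v, lam v * yx.2 (pairVar u v) ≤ lam0 * gamma yx.2 u := by
        rcases star_of_mem_feasible h hsink with ⟨hg, hs⟩ | ⟨hg, hs⟩
        · rw [hg, mul_one]
          exact hfacet.1 _ hs.mem_stab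
        · simp [hg, hs]
      change Λ yx ≤ c
      linarith
    intro yx h
    have h1 : Λ yx ≤ c := this h
    linarith [hΛ yx]
  have hface : ∀ g Z, IsConfiguration g Z → L (Z u) = lam0 * g u →
      ∃ Y, ∀ y, Y ≤ y → (y, point G (g, Z)) ∈ {yx ∈ polytope G p |
        ∑ v, lam v * yx.2 (pairVar u v) = lam0 * gamma yx.2 u} := by
    intro g Z h hc
    obtain ⟨Y, hY⟩ := h.exists_mem_feasible p
    refine ⟨Y, fun y hy => ⟨subset_convexHull ℝ _ (hY y hy), ?_⟩⟩
    rw [h.gamma_point, ← hc, hL]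
    rfl
  have hzero : ∀ v, IsStableVector (G.induce (posAnti G v))
      ((0 : ∀ v, posAnti G v → ℝ) v) := fun v => IsStableVector.zero _
  have hconf₀ := IsConfiguration.one (stable_update hzero hz₀)
  have hconf₁ := IsConfiguration.one (stable_update hzero hz₁)
  have hface₀ := hface _ _ hconf₀ (by simpa using hz₀c)
  obtain ⟨Y₀, hY₀⟩ := hface₀
  obtain ⟨Y₁, hY₁⟩ := hconf₁.exists_mem_feasible p
  refine facetDefining_of_sup_eq_top hΛ hvalid (hY₀ _ (le_max_left Y₀ Y₁))
    (subset_convexHull ℝ _ (hY₁ _ (le_max_right Y₀ Y₁))) ?_ ?_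
  · simp only [point_pairVar, hconf₁.gamma_point, Function.update_self]
    rw [← hL, Pi.one_apply, mul_one]
    exact hz₁c
  set D := vectorSpan ℝ {yx ∈ polytope G p |
    ∑ v, lam v * yx.2 (pairVar u v) = lam0 * gamma yx.2 u}
  rw [Prod.mk_sub_mk, sub_self, ← map_sub, Prod.mk_sub_mk, sub_self]
  set M := D ⊔ Submodule.span ℝ
    {((0 : ℝ), point G (0, Function.update (0 : ∀ v, posAnti G v → ℝ) u z₁ -
      Function.update (0 : ∀ v, posAnti G v → ℝ) u z₀))}
  have htop : M.comap (LinearMap.inr ℝ ℝ (RepVar G → ℝ) ∘ₗ point G) = ⊤ := by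
    refine eq_top_of_configuration_sub_mem hfacet' (fun v => ?_) (fun g Z g' Z' h h' hc hc' => ?_)
      (fun v hv => ?_) (d := z₁ - z₀) ?_ ?_
    · simpa only [hLs] using hnonneg v
    · refine Submodule.mem_sup_left ?_
      have := mk_sub_mem_vectorSpan (hface g Z h hc) (hface g' Z' h' hc') 0
      rwa [← map_sub] at this
    -- A source has no variable `x_vv`, so `point` discards this coordinate.
    · have : point G (Pi.single v 1, 0) = 0 := by
        ext (⟨w, hw⟩ | i)
        · have : w ≠ v := fun h => hw (h ▸ hv)
          simp [this]
        · rfl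
      change (0, point G (Pi.single v 1, 0)) ∈ M
      rw [this]
      exact M.zero_mem
    · rw [map_sub, hz₀c]
      exact sub_ne_zero.2 hz₁c
    · refine Submodule.mem_sup_right ?_
      rw [Pi.single_sub]
      exact Submodule.mem_span_singleton_self _
  refine top_le_iff.1 fun ⟨t, x⟩ _ => ?_
  obtain ⟨q, rfl⟩ := point_surjective x
  have h1 : (0, point G q) ∈ M := by
    have : q ∈ M.comap (LinearMap.inr ℝ ℝ (RepVar G → ℝ) ∘ₗ point G) := htop ▸ Submodule.mem_top
    exact this
  have h2 : (t, (0 : RepVar G → ℝ)) ∈ M := by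
    refine Submodule.mem_sup_left ?_
    have := mk_sub_mem_vectorSpan ⟨Y₀, hY₀⟩ ⟨Y₀, hY₀⟩ t
    rwa [sub_self] at this
  have h3 := M.add_mem h2 h1
  rwa [Prod.mk_add_mk, add_zero, zero_add] at h3
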